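/- All groups and digraphs are finite. For a group $G$ and $S\subseteq G$, the Cayley digraph $\mathrm{Cay}(G,S)$ has vertex set $G$, with $(g,h)$ an arc if and only if $gh^{-1}\in S$; it is a DRR if its automorphism group is exactly $G$ (acting by right multiplication). It has bipartition $\{B,G\setminus B\}$ if every arc joins a vertex of $B$ and a vertex of $G\setminus B$. For an abelian group $A$ and a subgroup $B$ of $A$ of index $2$, let $u(A,B)$ be the number of digraph-isomorphism classes of Cayley digraphs $\mathrm{Cay}(A,S)$, $S\subseteq A$, that have bipartition $\{B,A\setminus B\}$, and let $d(A,B)$ be the number of those classes that consist of DRRs (that is, contain such a $\mathrm{Cay}(A,S)$ which is a DRR; for Cayley digraphs over $A$ this property is isomorphism-invariant). (i) For every abelian group $A$ and every subgroup $B$ of $A$ of index $2$, $$u(A,B)\ \ge\ 2^{\frac{|A|}{2}-(\log_2|A|)^2}-3\cdot 2^{\frac{3|A|}{8}}.$$ (ii) The proportion $d(A,B)/u(A,B)$ tends to $1$ as $|A|\to\infty$, uniformly in the pair: for every $\varepsilon>0$ there is $N\in\mathbb{N}$ such that $\left|\frac{d(A,B)}{u(A,B)}-1\right|<\varepsilon$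 for every abelian group $A$ with $|A|\ge N$ and every subgroup $B$ of $A$ of index $2$. -/

import Mathlib

/-- The Cayley digraph `Cay(G, S)`: vertex set `G`, and `(g, h)` is an arc iff `g h⁻¹ ∈ S`. -/
def cayleyDigraph {G : Type*} [Group G] (S : Set G) : Digraph G where
  Adj g h := g * h⁻¹ ∈ S

/-- The automorphism group of a digraph, as a subgroup of the symmetric group on the vertices. -/
def digraphAut {V : Type*} (Γ : Digraph V) : Subgroup (Equiv.Perm V) where
  carrier := {φ | ∀ u v, Γ.Adj (φ u) (φ v) ↔ Γ.Adj u v}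
  one_mem' := fun _ _ => Iff.rfl
  mul_mem' := fun {_ ψ} hφ hψ u v => (hφ (ψ u) (ψ v)).trans (hψ u v)
  inv_mem' := fun {φ} hφ u v => by
    have h := hφ (φ⁻¹ u) (φ⁻¹ v)
    simpa using h.symm

/-- The group `G` acting on itself by right multiplication, as a permutation group. -/
def rightRegular (G : Type*) [Group G] : Subgroup (Equiv.Perm G) :=
  (MulAction.toPermHom Gᵐᵒᵖ G).range

/-- `Cay(G, S)` is a DRR: its automorphism group is `G`, acting by right multiplication. -/
def IsDRR {G : Type*} [Group G] (S : Set G) : Prop :=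
  digraphAut (cayleyDigraph S) = rightRegular G

/-- The digraph `Γ` is bipartite with bipartition `{X, V ∖ X}`: every arc joins a vertex of `X`
and a vertex of `V ∖ X`. -/
def HasBipartition {V : Type*} (Γ : Digraph V) (X : Set V) : Prop :=
  ∀ u v, Γ.Adj u v → (u ∈ X ∧ v ∉ X) ∨ (u ∉ X ∧ v ∈ X)

/-- The relation "being isomorphic" on digraphs with vertex set `V`. -/
def digraphIsoSetoid (V : Type*) : Setoid (Digraph V) where
  r Γ Δ := Nonempty (Γ.Adj ≃r Δ.Adj)
  iseqv :=
    { refl := fun Γ => ⟨RelIso.refl Γ.Adj⟩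
      symm := fun ⟨e⟩ => ⟨e.symm⟩
      trans := fun ⟨e⟩ ⟨f⟩ => ⟨e.trans f⟩ }

/-- Unlabelled digraphs: isomorphism classes of digraphs with vertex set `V`. -/
def UnlabelledDigraph (V : Type*) : Type _ :=
  Quotient (digraphIsoSetoid V)

/-- The isomorphism class of a digraph. -/
def Digraph.unlabelled {V : Type*} (Γ : Digraph V) : UnlabelledDigraph V :=
  Quotient.mk (digraphIsoSetoid V) Γ

/-- The isomorphism classes of the bipartite Cayley digraphs over `A` with bipartition
`{B, A ∖ B}`. -/
def unlabelledBipartiteCayley {A : Type*} [Group A] (B : Subgroup A) :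
    Set (UnlabelledDigraph A) :=
  {q | ∃ S : Set A, HasBipartition (cayleyDigraph S) (B : Set A) ∧
    (cayleyDigraph S).unlabelled = q}

/-- The isomorphism classes of the bipartite DRRs over `A` with bipartition `{B, A ∖ B}`.
(For finite `A`, being a DRR is invariant under isomorphism of Cayley digraphs over `A`, since it
says that the automorphism group has order `|A|`.) -/
def unlabelledBipartiteDRR {A : Type*} [Group A] (B : Subgroup A) :
    Set (UnlabelledDigraph A) :=
  {q | ∃ S : Set A, HasBipartition (cayleyDigraph S) (B : Set A) ∧ IsDRR S ∧
    (cayleyDigraph S).unlabelled = q}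

/-! Bipartite Cayley digraphs correspond to the `2 ^ (|A|/2)` subsets `S` of `A ∖ B`. The heart of
the proof is that few of them fail to give a DRR.

If `Cay(A, S)` is not a DRR, its automorphism group contains a group `G` covering the regular group
`R` in the subgroup lattice. If `G` normalises more than `R` inside itself, it contains a nontrivial
automorphism of `A`, and this preserves `S`. Otherwise `R` is self-normalising in `G`. Let `Z` be
the translations central in `G`: a conjugation count and a coboundary argument yield a single `e ≠
1` such that every `z ∉ Z` is sent to `z * e` by some element of `G` fixing `1`, so `S` is invariant
under `e` off `Z` (`exists_mulEquiv_or_exists_translation`).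

Either way membership in `S` is tied in pairs off a proper subgroup, which leaves at most `2 ^
(3|A|/8)` sets per choice of data. There are at most `2 ^ (log₂|A|)²` automorphisms, and at most
`|A|²` choices of `e` and of a character whose kernel contains `Z`. Finally, isomorphic DRRs differ
by an automorphism of `A`, so passing to classes costs only a factor `|Aut A|`. -/

theorem perm_apply_inv_apply {α : Type*} (g : Equiv.Perm α) (x : α) : g (g⁻¹ x) = x :=
  g.apply_symm_apply x

theorem mem_rightRegular_iff {G : Type*} [Group G] {φ : Equiv.Perm G} :
    φ ∈ rightRegular G ↔ ∃ a, ∀ x, φ x = x * a := by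
  constructor
  · rintro ⟨a, rfl⟩
    exact ⟨a.unop, fun x => rfl⟩
  · rintro ⟨a, ha⟩
    exact ⟨MulOpposite.op a, Equiv.ext fun x => (ha x).symm⟩

theorem mulRight_mem_rightRegular {G : Type*} [Group G] (a : G) :
    Equiv.mulRight a ∈ rightRegular G :=
  mem_rightRegular_iff.2 ⟨a, fun _ => rfl⟩

theorem eq_one_of_mem_rightRegular {G : Type*} [Group G] {φ : Equiv.Perm G}
    (h : φ ∈ rightRegular G) (h1 : φ 1 = 1) : φ = 1 := by
  obtain ⟨a, ha⟩ := mem_rightRegular_iff.1 h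
  have : a = 1 := by simpa [h1] using (ha 1).symm
  subst this
  ext x
  simp [ha]

/-- The elements `c` whose right translation `x ↦ x * c` commutes with every permutation in `G`. -/
def centralTranslations {A : Type*} [Group A] (G : Subgroup (Equiv.Perm A)) : Subgroup A where
  carrier := {c | ∀ g ∈ G, ∀ x, g (x * c) = g x * c}
  one_mem' := by simp
  mul_mem' := by
    intro a b ha hb g hg x
    rw [← mul_assoc, hb g hg, ha g hg, mul_assoc]
  inv_mem' := by
    intro a ha g hg x
    have := ha g hg (x * a⁻¹)
    rw [inv_mul_cancel_right] at this
    rw [this, mul_inv_cancel_right]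

/-! ### Minimal overgroups of the regular representation. -/

section Structure

variable {A : Type*} [CommGroup A] {G : Subgroup (Equiv.Perm A)}

theorem exists_mulEquiv_mem_of_normalizing (hR : rightRegular A ≤ G) {g : Equiv.Perm A}
    (hg : g ∈ G) (hgR : g ∉ rightRegular A)
    (hn : ∀ a, ∃ b, ∀ x, g (x * a) = g x * b) :
    ∃ φ : A ≃* A, φ ≠ 1 ∧ φ.toEquiv ∈ G := by
  have key : ∀ x a, g (x * a) = g x * ((g 1)⁻¹ * g a) := by
    intro x a
    obtain ⟨b, hb⟩ := hn a
    have := hb 1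
    rw [one_mul] at this
    rw [hb, this, inv_mul_cancel_left]
  let φ : A ≃* A :=
    { (Equiv.mulRight (g 1)⁻¹ * g : Equiv.Perm A) with
      map_mul' := by
        intro x a
        change g (x * a) * (g 1)⁻¹ = g x * (g 1)⁻¹ * (g a * (g 1)⁻¹)
        rw [key, mul_assoc, mul_assoc, mul_assoc] }
  have hφ : ∀ x, φ x = g x * (g 1)⁻¹ := fun x => rfl
  refine ⟨φ, fun h => hgR (mem_rightRegular_iff.2 ⟨g 1, fun x => ?_⟩),
    G.mul_mem (hR (mulRight_mem_rightRegular _)) hg⟩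
  have := hφ x
  rw [h] at this
  exact (mul_inv_eq_iff_eq_mul.1 this.symm)

/-- The centraliser in `G` of the translation by `b` contains the regular group because `A` is
abelian, so by the covering relation it is the regular group or `G`. In the first case `g⁻¹` would
normalise the regular group, against `hN`. -/
theorem mem_centralTranslations_of_conj (hG : rightRegular A ⋖ G)
    (hN : ∀ g ∈ G, (∀ a, ∃ b, ∀ x, g (x * a) = g x * b) → g ∈ rightRegular A)
    {g : Equiv.Perm A} (hg : g ∈ G) (hgR : g ∉ rightRegular A) {b c : A}
    (hbc : ∀ x, g (x * b) = g x * c) : b ∈ centralTranslations G := by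
  let H : Subgroup (Equiv.Perm A) :=
    { carrier := {h | h ∈ G ∧ ∀ x, h (x * b) = h x * b}
      one_mem' := ⟨G.one_mem, fun _ => rfl⟩
      mul_mem' := by
        rintro h k ⟨hh, hh'⟩ ⟨hk, hk'⟩
        refine ⟨G.mul_mem hh hk, fun x => ?_⟩
        simp only [Equiv.Perm.mul_apply, hk', hh']
      inv_mem' := by
        rintro h ⟨hh, hh'⟩
        refine ⟨G.inv_mem hh, fun x => ?_⟩
        rw [Equiv.Perm.inv_eq_iff_eq, hh', perm_apply_inv_apply] }
  have hRH : rightRegular A ≤ H := fun h hh => ⟨hG.le hh, fun x => by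
    obtain ⟨a, ha⟩ := mem_rightRegular_iff.1 hh
    rw [ha, ha, mul_right_comm]⟩
  have hHG : H ≤ G := fun h hh => hh.1
  rcases hG.eq_or_eq hRH hHG with h | h
  · exfalso
    refine hgR (inv_mem_iff.1 (hN g⁻¹ (G.inv_mem hg) fun a => ?_))
    have hmem : g⁻¹ * Equiv.mulRight a * g ∈ H := by
      refine ⟨G.mul_mem (G.mul_mem (G.inv_mem hg) (hG.le (mulRight_mem_rightRegular a))) hg,
        fun x => ?_⟩
      simp only [Equiv.Perm.mul_apply, Equiv.coe_mulRight, hbc]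
      rw [Equiv.Perm.inv_eq_iff_eq, hbc, perm_apply_inv_apply, mul_right_comm]
    rw [h] at hmem
    obtain ⟨b', hb'⟩ := mem_rightRegular_iff.1 hmem
    refine ⟨b', fun y => ?_⟩
    have := hb' (g⁻¹ y)
    simpa using this
  · intro k hk x
    rw [← h] at hk
    exact hk.2 x

/-- By counting, every element of `G` sending `1` outside `Z` is a conjugate of a translation by
some `b ∉ Z`. Such a conjugate has no fixed point. -/
theorem apply_one_mem_centralTranslations_of_fixed [Finite A] (hG : rightRegular A ⋖ G)
    (hN : ∀ g ∈ G, (∀ a, ∃ b, ∀ x, g (x * a) = g x * b) → g ∈ rightRegular A)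
    {h : Equiv.Perm A} (hh : h ∈ G) {p : A} (hp : h p = p) :
    h 1 ∈ centralTranslations G := by
  set Z := centralTranslations G with hZ
  by_contra h1
  let T := {g : Equiv.Perm A // g ∈ G ∧ g 1 = 1} × {b : A // b ∉ Z}
  let conj : T → Equiv.Perm A := fun q => q.1.1⁻¹ * Equiv.mulRight q.2.1 * q.1.1
  have conj_mem : ∀ q, conj q ∈ G := fun q =>
    G.mul_mem (G.mul_mem (G.inv_mem q.1.2.1) (hG.le (mulRight_mem_rightRegular _))) q.1.2.1
  have conj_one : ∀ q, conj q 1 ∉ Z := by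
    rintro ⟨⟨x, hx, hx1⟩, b, hb⟩ hmem
    apply hb
    have e : conj ⟨⟨x, hx, hx1⟩, b, hb⟩ 1 = x⁻¹ b := by simp [conj, hx1]
    rw [e] at hmem
    have := hmem x hx 1
    rw [one_mul, perm_apply_inv_apply, hx1, one_mul] at this
    rwa [this]
  -- Each element of `G` is uniquely a stabiliser element followed by a translation. Splitting the
  -- conjugates this way makes conjugation a self-map of the finite set `T`, so injectivity gives
  -- surjectivity.
  let f : T → T := fun q =>
    ⟨⟨Equiv.mulRight (conj q 1)⁻¹ * conj q,
      G.mul_mem (hG.le (mulRight_mem_rightRegular _)) (conj_mem q), by simp⟩,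
      conj q 1, conj_one q⟩
  have hf : Function.Injective f := by
    intro q r hqr
    have e2 : conj q 1 = conj r 1 := congrArg (fun t : T => t.2.1) hqr
    have e1 : Equiv.mulRight (conj q 1)⁻¹ * conj q = Equiv.mulRight (conj r 1)⁻¹ * conj r :=
      congrArg (fun t : T => t.1.1) hqr
    rw [e2, mul_right_inj] at e1
    obtain ⟨⟨x, hx, hx1⟩, b, hb⟩ := q
    obtain ⟨⟨y, hy, hy1⟩, c, hc⟩ := r
    have e3 : x⁻¹ * Equiv.mulRight b * x = y⁻¹ * Equiv.mulRight c * y := e1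
    have hw : ∀ v, (x * y⁻¹) (v * c) = (x * y⁻¹) v * b := by
      intro v
      have := congrArg (fun k : Equiv.Perm A => x (k (y⁻¹ v))) e3
      simpa using this.symm
    have hxy : x * y⁻¹ = 1 := by
      apply eq_one_of_mem_rightRegular
      · by_contra hnR
        exact hc (mem_centralTranslations_of_conj hG hN (G.mul_mem hx (G.inv_mem hy)) hnR hw)
      · have : y⁻¹ 1 = 1 := by rw [Equiv.Perm.inv_eq_iff_eq, hy1]
        rw [Equiv.Perm.mul_apply, this, hx1]
    have hxy' : x = y := mul_inv_eq_one.1 hxy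
    subst hxy'
    have hcb : c = b := by simpa using hw 1
    subst hcb
    rfl
  obtain ⟨⟨⟨x, hx, hx1⟩, b, hb⟩, hq⟩ := Finite.surjective_of_injective hf
    ⟨⟨Equiv.mulRight (h 1)⁻¹ * h, G.mul_mem (hG.le (mulRight_mem_rightRegular _)) hh,
      by simp⟩, h 1, h1⟩
  have e2 : (x⁻¹ * Equiv.mulRight b * x) 1 = h 1 := congrArg (fun t : T => t.2.1) hq
  have e1 : Equiv.mulRight ((x⁻¹ * Equiv.mulRight b * x) 1)⁻¹ * (x⁻¹ * Equiv.mulRight b * x)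
      = Equiv.mulRight (h 1)⁻¹ * h := congrArg (fun t : T => t.1.1) hq
  rw [e2, mul_right_inj] at e1
  have e3 := congrArg (fun k : Equiv.Perm A => x (k p)) e1
  simp only [Equiv.Perm.mul_apply, Equiv.coe_mulRight, perm_apply_inv_apply, hp,
    mul_eq_left] at e3
  exact hb (e3.symm ▸ Z.one_mem)

/-- A group of permutations covering the regular representation of an abelian group contains
either a nontrivial automorphism of the group, or permutations fixing `1` that realise one and
the same nontrivial translation at all points outside a proper subgroup. -/
theorem exists_mulEquiv_or_exists_translation [Finite A] (hG : rightRegular A ⋖ G) :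
    (∃ φ : A ≃* A, φ ≠ 1 ∧ φ.toEquiv ∈ G) ∨
      ∃ Z : Subgroup A, Z ≠ ⊤ ∧ ∃ e : A, e ≠ 1 ∧ ∀ z ∉ Z, ∃ h ∈ G, h 1 = 1 ∧ h z = z * e := by
  by_cases hN : ∀ g ∈ G, (∀ a, ∃ b, ∀ x, g (x * a) = g x * b) → g ∈ rightRegular A
  swap
  · left
    push Not at hN
    obtain ⟨g, hg, hn, hgR⟩ := hN
    exact exists_mulEquiv_mem_of_normalizing hG.le hg hgR hn
  right
  set Z := centralTranslations G with hZ
  let T := {g : Equiv.Perm A // g ∈ G ∧ g 1 = 1}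
  have inv_one : ∀ g : T, g.1⁻¹ 1 = 1 := fun g => by
    rw [Equiv.Perm.inv_eq_iff_eq, g.2.2]
  let t : T → A → A := fun g y => y⁻¹ * g.1 y
  have ht : ∀ g y, g.1 y = y * t g y := fun g y => by simp [t]
  have htZ : ∀ g y, t g y ∈ Z := by
    rintro ⟨g, hg, hg1⟩ y
    -- The conjugate of `g` by the translation by `y` fixes `y⁻¹` and sends `1` to `t g y`.
    have := apply_one_mem_centralTranslations_of_fixed hG hN (p := y⁻¹)
      (h := Equiv.mulRight y⁻¹ * g * Equiv.mulRight y)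
      (G.mul_mem (G.mul_mem (hG.le (mulRight_mem_rightRegular _)) hg)
        (hG.le (mulRight_mem_rightRegular _))) (by simp [hg1])
    simpa [t, mul_comm] using this
  have hinv : ∀ (g : T) y, g.1⁻¹ y = y * (t g y)⁻¹ := by
    intro g y
    rw [Equiv.Perm.inv_eq_iff_eq, Z.inv_mem (htZ g y) g.1 g.2.1, ht]
    simp
  -- `D y g` is built so that its displacement is the coboundary of `t g`, that is, the failure of
  -- `t g` to be multiplicative at the pair `(x, y)`.
  let D : A → T → T := fun y g =>
    ⟨g.1⁻¹ * Equiv.mulRight (t g y)⁻¹ * (Equiv.mulRight y⁻¹ * g.1 * Equiv.mulRight y),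
      G.mul_mem (G.mul_mem (G.inv_mem g.2.1) (hG.le (mulRight_mem_rightRegular _)))
        (G.mul_mem (G.mul_mem (hG.le (mulRight_mem_rightRegular _)) g.2.1)
          (hG.le (mulRight_mem_rightRegular _))), by
      simp only [Equiv.Perm.mul_apply, Equiv.coe_mulRight, one_mul, ht g y]
      rw [mul_right_comm y, mul_inv_cancel, one_mul, mul_inv_cancel, inv_one]⟩
  have hD : ∀ y g x, t (D y g) x = t g (x * y) * (t g x)⁻¹ * (t g y)⁻¹ := by
    intro y g x
    have e : (D y g).1 x = g.1⁻¹ (x * (t g (x * y) * (t g y)⁻¹)) := by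
      simp only [D, Equiv.Perm.mul_apply, Equiv.coe_mulRight, ht g (x * y)]
      congr 1
      rw [mul_right_comm x y, mul_inv_cancel_right, mul_assoc]
    have e' := Z.mul_mem (htZ g (x * y)) (Z.inv_mem (htZ g y)) g.1⁻¹ (G.inv_mem g.2.1) x
    rw [e'] at e
    change x⁻¹ * (D y g).1 x = _
    rw [e, hinv, mul_assoc x, inv_mul_cancel_left, ← mul_assoc, mul_comm (t g x)⁻¹]
  have hDsurj : ∀ y ∉ Z, Function.Surjective (D y) := by
    intro y hy
    apply Finite.surjective_of_injective
    intro g h hgh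
    have e : ∀ x, t g (x * y) * (t g x)⁻¹ * (t g y)⁻¹
        = t h (x * y) * (t h x)⁻¹ * (t h y)⁻¹ := fun x => by rw [← hD, ← hD, hgh]
    -- Equal coboundaries make `h⁻¹ * g` conjugate the translation by `y` to a translation. As `y ∉
    -- Z`, this forces `h⁻¹ * g` to be trivial.
    have hk : ∀ x, (h.1⁻¹ * g.1) x = x * (t g x * (t h x)⁻¹) := by
      intro x
      rw [Equiv.Perm.mul_apply, ht g x, htZ g x h.1⁻¹ (G.inv_mem h.2.1), hinv, mul_assoc,
        mul_comm (t g x)]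
    have hk1 : h.1⁻¹ * g.1 = 1 := by
      apply eq_one_of_mem_rightRegular
      · by_contra hnR
        refine hy (mem_centralTranslations_of_conj hG hN (G.mul_mem (G.inv_mem h.2.1) g.2.1) hnR
          (c := (h.1⁻¹ * g.1) y) fun x => ?_)
        rw [hk, hk, hk]
        have e' : t g (x * y) = t h (x * y) * (t h x)⁻¹ * (t h y)⁻¹ * t g x * t g y := by
          rw [← e x, mul_right_comm _ _ (t g x), inv_mul_cancel_right, inv_mul_cancel_right]
        apply Additive.ofMul.injective
        simp only [e', ofMul_mul, ofMul_inv]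
        abel
      · rw [Equiv.Perm.mul_apply, g.2.2, inv_one]
    exact Subtype.ext (inv_mul_eq_one.1 hk1).symm
  obtain ⟨g₀, hg₀, hg₀R⟩ := SetLike.exists_of_lt hG.lt
  let g : T := ⟨Equiv.mulRight (g₀ 1)⁻¹ * g₀,
    G.mul_mem (hG.le (mulRight_mem_rightRegular _)) hg₀, by simp⟩
  obtain ⟨y, hy⟩ : ∃ y, g.1 y ≠ y := by
    by_contra! hall
    refine hg₀R (mem_rightRegular_iff.2 ⟨g₀ 1, fun x => ?_⟩)
    exact mul_inv_eq_iff_eq_mul.1 (hall x)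
  have hyZ : y ∉ Z := fun hyZ => hy <| by
    have := hyZ g.1 g.2.1 1
    rwa [g.2.2, one_mul] at this
  refine ⟨Z, fun h => hyZ (h ▸ Subgroup.mem_top y), t g y, fun h => hy (by rw [ht, h, mul_one]),
    fun z hz => ?_⟩
  -- The coboundary is symmetric in its two arguments: with `D z k = g`, the displacement of `D y k`
  -- at `z` is that of `g` at `y`, hence independent of `z`.
  obtain ⟨k, hk⟩ := hDsurj z hz g
  refine ⟨(D y k).1, (D y k).2.1, (D y k).2.2, ?_⟩
  rw [ht, hD, ← hk, hD, mul_comm y z, mul_right_comm]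

theorem exists_invariance_of_not_isDRR [Finite A] {S : Set A} (hS : ¬ IsDRR S) :
    (∃ φ : A ≃* A, φ ≠ 1 ∧ ∀ x, x ∈ S ↔ φ x ∈ S) ∨
      ∃ Z : Subgroup A, Z ≠ ⊤ ∧ ∃ e : A, e ≠ 1 ∧ ∀ z ∉ Z, (z ∈ S ↔ z * e ∈ S) := by
  have hle : rightRegular A ≤ digraphAut (cayleyDigraph S) := by
    intro φ hφ u v
    obtain ⟨a, ha⟩ := mem_rightRegular_iff.1 hφ
    simp [cayleyDigraph, ha]
  obtain ⟨G, hG, hGle⟩ := exists_covBy_le_of_lt (lt_of_le_of_ne hle (Ne.symm hS))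
  have hstab : ∀ h ∈ G, h 1 = 1 → ∀ x, x ∈ S ↔ h x ∈ S := by
    intro h hh h1 x
    have := hGle hh x 1
    simpa [cayleyDigraph, h1] using this.symm
  rcases exists_mulEquiv_or_exists_translation hG with ⟨φ, hφ, hφG⟩ | ⟨Z, hZ, e, he, h⟩
  · exact Or.inl ⟨φ, hφ, hstab _ hφG φ.map_one⟩
  · refine Or.inr ⟨Z, hZ, e, he, fun z hz => ?_⟩
    obtain ⟨k, hk, hk1, hkz⟩ := h z hz
    rw [← hkz]
    exact hstab k hk hk1 z

end Structure

/-! ### Counting constrained families of sets. -/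

/-- Points lying in the same members of `𝓕` form classes, and a member is determined by the classes
it meets. Each class with nonempty trace has two points in `Y`, or one point that is counted in both
`Y` and `F`. -/
theorem exists_ncard_le_two_pow_of_partner {α : Type*} [Finite α] {Y F : Set α}
    {𝓕 : Set (Set α)} (hY : ∀ S ∈ 𝓕, S ⊆ Y)
    (hpartner : ∀ x ∈ Y, x ∉ F → ∃ y, y ≠ x ∧ ∀ S ∈ 𝓕, (x ∈ S ↔ y ∈ S)) :
    ∃ c, 2 * c ≤ Y.ncard + F.ncard ∧ 𝓕.ncard ≤ 2 ^ c := by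
  classical
  have := Fintype.ofFinite α
  let k : α → Set (Set α) := fun x => {S ∈ 𝓕 | x ∈ S}
  let I : Finset (Set (Set α)) := {i ∈ Y.toFinset.image k | i ≠ ∅}
  refine ⟨I.card, ?_, ?_⟩
  · have hfib : ∀ i ∈ I, 2 ≤ {x ∈ Y.toFinset | k x = i}.card + {x ∈ F.toFinset | k x = i}.card := by
      intro i hi
      obtain ⟨hi, hi0⟩ := Finset.mem_filter.1 hi
      obtain ⟨x, hx, rfl⟩ := Finset.mem_image.1 hi
      rw [Set.mem_toFinset] at hx
      by_cases hxF : x ∈ F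
      · have h1 : 0 < {z ∈ Y.toFinset | k z = k x}.card :=
          Finset.card_pos.2 ⟨x, by simp [hx]⟩
        have h2 : 0 < {z ∈ F.toFinset | k z = k x}.card :=
          Finset.card_pos.2 ⟨x, by simp [hxF]⟩
        omega
      · obtain ⟨y, hyx, hy⟩ := hpartner x hx hxF
        have hky : k y = k x := by
          ext S
          exact ⟨fun h => ⟨h.1, (hy S h.1).2 h.2⟩, fun h => ⟨h.1, (hy S h.1).1 h.2⟩⟩
        obtain ⟨S, hS⟩ := Set.nonempty_iff_ne_empty.2 hi0
        rw [← hky] at hS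
        have h1 : 1 < {z ∈ Y.toFinset | k z = k x}.card :=
          Finset.one_lt_card.2 ⟨x, by simp [hx], y, by simp [hky, hY S hS.1 hS.2], hyx.symm⟩
        omega
    have hsum : ∀ s : Finset α, ∑ i ∈ I, {x ∈ s | k x = i}.card ≤ s.card := by
      intro s
      rw [← Finset.card_biUnion]
      · refine Finset.card_le_card fun x hx => ?_
        obtain ⟨i, -, hi⟩ := Finset.mem_biUnion.1 hx
        exact (Finset.mem_filter.1 hi).1
      · intro i _ j _ hij
        refine Finset.disjoint_left.2 fun x hx hx' => hij ?_
        rw [← (Finset.mem_filter.1 hx).2, (Finset.mem_filter.1 hx').2]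
    calc 2 * I.card = ∑ i ∈ I, 2 := by simp [mul_comm]
      _ ≤ ∑ i ∈ I, ({x ∈ Y.toFinset | k x = i}.card + {x ∈ F.toFinset | k x = i}.card) :=
        Finset.sum_le_sum hfib
      _ ≤ Y.toFinset.card + F.toFinset.card := by
        rw [Finset.sum_add_distrib]
        exact add_le_add (hsum _) (hsum _)
      _ = Y.ncard + F.ncard := by simp only [Set.ncard_eq_toFinset_card']
  · rw [← Finset.card_powerset, ← Set.ncard_coe_finset]
    refine Set.ncard_le_ncard_of_injOn (fun S => S.toFinset.image k) ?_ ?_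
    · intro S hS
      simp only [Finset.coe_powerset, Set.mem_preimage, Set.mem_powerset_iff, Finset.coe_subset]
      intro i hi
      obtain ⟨x, hx, rfl⟩ := Finset.mem_image.1 hi
      rw [Set.mem_toFinset] at hx
      refine Finset.mem_filter.2 ⟨Finset.mem_image.2 ⟨x, by simpa using hY S hS hx, rfl⟩, ?_⟩
      exact Set.nonempty_iff_ne_empty.1 ⟨S, hS, hx⟩
    · have hle : ∀ S ∈ 𝓕, ∀ T ∈ 𝓕, S.toFinset.image k = T.toFinset.image k → S ⊆ T := by
        intro S hS T hT h x hx
        have hx' : k x ∈ T.toFinset.image k :=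
          h ▸ Finset.mem_image.2 ⟨x, Set.mem_toFinset.2 hx, rfl⟩
        obtain ⟨y, hy, hyx⟩ := Finset.mem_image.1 hx'
        have : T ∈ k x := hyx ▸ ⟨hT, Set.mem_toFinset.1 hy⟩
        exact this.2
      exact fun S hS T hT h => (hle S hS T hT h).antisymm (hle T hT S hS h.symm)

theorem ncard_le_card_mul_of_subset_iUnion {ι α : Type*} [Finite ι] [Finite α] {s : Set α}
    {t : ι → Set α} (h : s ⊆ ⋃ i, t i) {c : ℝ} (hc : ∀ i, ((t i).ncard : ℝ) ≤ c) :
    (s.ncard : ℝ) ≤ Nat.card ι * c := by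
  have := Fintype.ofFinite ι
  have h1 : s.ncard ≤ ∑ i, (t i).ncard := by
    refine (Set.ncard_le_ncard h).trans ?_
    simpa using Finset.univ.set_ncard_biUnion_le t
  calc (s.ncard : ℝ) ≤ ((∑ i, (t i).ncard : ℕ) : ℝ) := by exact_mod_cast h1
    _ = ∑ i, ((t i).ncard : ℝ) := by push_cast; rfl
    _ ≤ ∑ _i : ι, c := Finset.sum_le_sum fun i _ => hc i
    _ = Nat.card ι * c := by simp

/-! ### Generators and the number of automorphisms. -/

theorem Subgroup.two_mul_card_le_of_lt {G : Type*} [Group G] [Finite G] {H K : Subgroup G}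
    (h : H < K) : 2 * Nat.card H ≤ Nat.card K := by
  obtain ⟨m, hm⟩ := Subgroup.card_dvd_of_le h.le
  have hlt : Nat.card H < Nat.card K := by
    refine lt_of_le_of_ne (Subgroup.card_le_of_le h.le) fun heq => h.ne ?_
    exact Subgroup.eq_of_le_of_card_ge h.le heq.ge
  have hm2 : 2 ≤ m := by
    by_contra! hm2
    interval_cases m <;> omega
  rw [hm, mul_comm]
  exact Nat.mul_le_mul_left _ hm2

/-- Each new generator outside the current closure at least doubles it, so a largest `s` with `2 ^
s.card` at most the order of its closure generates. -/
theorem exists_finset_closure_eq_top_two_pow_le (G : Type*) [Group G] [Finite G] :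
    ∃ s : Finset G, Subgroup.closure (s : Set G) = ⊤ ∧ 2 ^ s.card ≤ Nat.card G := by
  classical
  obtain ⟨s, hs, hmax⟩ := Set.exists_max_image
    {s : Finset G | 2 ^ s.card ≤ Nat.card (Subgroup.closure (s : Set G))} Finset.card
    (Set.toFinite _) ⟨∅, by simp⟩
  refine ⟨s, ?_, hs.trans (Subgroup.card_le_card_group _)⟩
  by_contra hne
  obtain ⟨x, -, hx⟩ := SetLike.exists_of_lt (lt_top_iff_ne_top.2 hne)
  have hxs : x ∉ s := fun h => hx (Subgroup.subset_closure h)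
  have hlt : Subgroup.closure (s : Set G) < Subgroup.closure ((insert x s : Finset G) : Set G) :=
    lt_of_le_of_ne (Subgroup.closure_mono (by simp)) fun h =>
      hx (h ▸ Subgroup.subset_closure (by simp))
  have hmem : 2 ^ (insert x s).card
      ≤ Nat.card (Subgroup.closure ((insert x s : Finset G) : Set G)) := by
    rw [Finset.card_insert_of_notMem hxs, pow_succ, mul_comm]
    exact (Nat.mul_le_mul_left 2 hs).trans (Subgroup.two_mul_card_le_of_lt hlt)
  have := hmax _ hmem
  rw [Finset.card_insert_of_notMem hxs] at this
  omega

theorem card_eq_two_rpow_logb (G : Type*) [Group G] [Finite G] :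
    (Nat.card G : ℝ) = 2 ^ Real.logb 2 (Nat.card G) :=
  (Real.rpow_logb two_pos (by norm_num) (by exact_mod_cast Nat.card_pos)).symm

theorem card_mulEquiv_le (G : Type*) [Group G] [Finite G] :
    (Nat.card (G ≃* G) : ℝ) ≤ 2 ^ (Real.logb 2 (Nat.card G)) ^ 2 := by
  obtain ⟨s, hs, hcard⟩ := exists_finset_closure_eq_top_two_pow_le G
  have h1 : Nat.card (G ≃* G) ≤ Nat.card G ^ s.card := by
    have hinj : Function.Injective fun (φ : G ≃* G) (x : s) => φ x.1 := by
      intro φ ψ h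
      have := MonoidHom.eq_of_eqOn_dense hs (f := φ.toMonoidHom) (g := ψ.toMonoidHom)
        fun x hx => congrFun h ⟨x, hx⟩
      exact MulEquiv.ext fun x => DFunLike.congr_fun this x
    have := Nat.card_le_card_of_injective _ hinj
    simpa [Nat.card_fun] using this
  have hlog : (s.card : ℝ) ≤ Real.logb 2 (Nat.card G) := by
    rw [Real.le_logb_iff_rpow_le one_lt_two (by exact_mod_cast Nat.card_pos), Real.rpow_natCast]
    exact_mod_cast hcard
  have hlog0 : 0 ≤ Real.logb 2 (Nat.card G : ℝ) := (Nat.cast_nonneg _).trans hlog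
  calc (Nat.card (G ≃* G) : ℝ) ≤ (Nat.card G : ℝ) ^ s.card := by exact_mod_cast h1
    _ = 2 ^ (Real.logb 2 (Nat.card G) * s.card) := by
      rw [Real.rpow_mul two_pos.le, ← card_eq_two_rpow_logb, Real.rpow_natCast]
    _ ≤ _ := by
      apply Real.rpow_le_rpow_of_exponent_le one_le_two
      rw [sq]
      exact mul_le_mul_of_nonneg_left hlog hlog0

/-! ### Connection sets avoiding a subgroup of index two. -/

section Index

variable {A : Type*} [Group A] {B : Subgroup A}

theorem two_mul_ncard_compl_of_index_eq_two [Finite A] (hB : B.index = 2) :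
    2 * ((B : Set A)ᶜ).ncard = Nat.card A := by
  have h1 := B.card_mul_index
  have h2 := Set.ncard_add_ncard_compl (B : Set A)
  have h3 : (B : Set A).ncard = Nat.card B := rfl
  rw [hB] at h1
  omega

/-- Multiplying by an element of `K ∖ B` embeds `K ∖ B` into `K ∩ B`, so `K ∖ B` is at most half of
`K`, which is at most half of `A`. -/
theorem four_mul_ncard_compl_inter_le [Finite A] (hB : B.index = 2) {K : Subgroup A}
    (hK : K ≠ ⊤) : 4 * ((B : Set A)ᶜ ∩ K).ncard ≤ Nat.card A := by
  rcases ((B : Set A)ᶜ ∩ K).eq_empty_or_nonempty with h | ⟨c, hcB, hcK⟩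
  · simp [h]
  have h1 : ((B : Set A)ᶜ ∩ K).ncard ≤ ((B : Set A) ∩ K).ncard := by
    refine Set.ncard_le_ncard_of_injOn (· * c) ?_ (mul_left_injective c).injOn
    rintro x ⟨hxB, hxK⟩
    exact ⟨(Subgroup.mul_mem_iff_of_index_two hB).2 (iff_of_false hxB hcB), K.mul_mem hxK hcK⟩
  have h2 : ((B : Set A)ᶜ ∩ K).ncard + ((B : Set A) ∩ K).ncard = Nat.card K := by
    rw [← Set.ncard_union_eq, ← Set.union_inter_distrib_right, Set.compl_union_self,
      Set.univ_inter]
    · rfl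
    · exact Set.disjoint_left.2 fun x hx hx' => hx.1 hx'.1
  have h3 : 2 * Nat.card K ≤ Nat.card (⊤ : Subgroup A) :=
    Subgroup.two_mul_card_le_of_lt (lt_top_iff_ne_top.2 hK)
  rw [Subgroup.card_top] at h3
  omega

/-- The exponent is half of `|A|/2 + |A|/4`: the size of `A ∖ B` plus the bound for its unpaired
part in `K`. -/
theorem ncard_invariant_off_subgroup_le [Finite A] (hB : B.index = 2) {K : Subgroup A}
    (hK : K ≠ ⊤) {f : A → A} (hf : ∀ x ∉ K, f x ≠ x) :
    (({S : Set A | S ⊆ (B : Set A)ᶜ ∧ ∀ x ∉ K, (x ∈ S ↔ f x ∈ S)} : Set (Set A)).ncard : ℝ)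
      ≤ 2 ^ (3 * (Nat.card A : ℝ) / 8) := by
  obtain ⟨c, hc, hle⟩ := exists_ncard_le_two_pow_of_partner (Y := (B : Set A)ᶜ)
    (F := (B : Set A)ᶜ ∩ K)
    (𝓕 := {S : Set A | S ⊆ (B : Set A)ᶜ ∧ ∀ x ∉ K, (x ∈ S ↔ f x ∈ S)}) (fun S hS => hS.1)
    fun x hx hxF => by
      have hxK : x ∉ K := fun h => hxF ⟨hx, h⟩
      exact ⟨f x, hf x hxK, fun S hS => hS.2 x hxK⟩
  have h1 := two_mul_ncard_compl_of_index_eq_two hB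
  have h2 := four_mul_ncard_compl_inter_le hB hK
  have h3 : 8 * c ≤ 3 * Nat.card A := by omega
  calc _ ≤ (2 : ℝ) ^ c := by exact_mod_cast hle
    _ = 2 ^ (c : ℝ) := (Real.rpow_natCast _ _).symm
    _ ≤ _ := by
      apply Real.rpow_le_rpow_of_exponent_le one_le_two
      have : (8 : ℝ) * c ≤ 3 * Nat.card A := by exact_mod_cast h3
      linarith

theorem hasBipartition_cayleyDigraph_iff (hB : B.index = 2) {S : Set A} :
    HasBipartition (cayleyDigraph S) (B : Set A) ↔ S ⊆ (B : Set A)ᶜ := by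
  constructor
  · intro h x hx hxB
    have := h x 1 (by simpa [cayleyDigraph] using hx)
    simp only [SetLike.mem_coe, B.one_mem, not_true, and_false, and_true, false_or] at this
    exact this hxB
  · intro h u v huv
    have := h huv
    simp only [Set.mem_compl_iff, SetLike.mem_coe, Subgroup.mul_mem_iff_of_index_two hB,
      inv_mem_iff] at this
    simp only [SetLike.mem_coe]
    tauto

end Index

/-- The connection sets of the bipartite Cayley digraphs that are not DRRs. -/
def bipartiteNonDRR {A : Type*} [Group A] (B : Subgroup A) : Set (Set A) :=
  {S | HasBipartition (cayleyDigraph S) (B : Set A) ∧ ¬ IsDRR S}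

/-- Enlarging `Z` to a kernel weakens the invariance off `Z` but replaces arbitrary subgroups by at
most `|A|` characters. -/
theorem exists_character_ker_of_ne_top {A : Type*} [CommGroup A] [Finite A] {Z : Subgroup A}
    (hZ : Z ≠ ⊤) : ∃ χ : A →* ℂˣ, χ ≠ 1 ∧ Z ≤ χ.ker := by
  obtain ⟨x, -, hx⟩ := SetLike.exists_of_lt (lt_top_iff_ne_top.2 hZ)
  obtain ⟨χ, hχ⟩ := CommGroup.exists_apply_ne_one_of_hasEnoughRootsOfUnity (A ⧸ Z) ℂ
    (a := (x : A ⧸ Z)) (by rwa [Ne, QuotientGroup.eq_one_iff])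
  refine ⟨χ.comp (QuotientGroup.mk' Z), fun h => hχ (DFunLike.congr_fun h x), fun z hz => ?_⟩
  rw [MonoidHom.mem_ker, MonoidHom.comp_apply, QuotientGroup.mk'_apply,
    (QuotientGroup.eq_one_iff z).2 hz, map_one]

theorem ncard_bipartiteNonDRR_le {A : Type*} [CommGroup A] [Finite A] {B : Subgroup A}
    (hB : B.index = 2) :
    ((bipartiteNonDRR B).ncard : ℝ) ≤ (2 ^ (Real.logb 2 (Nat.card A)) ^ 2 + (Nat.card A : ℝ) ^ 2)
      * 2 ^ (3 * (Nat.card A : ℝ) / 8) := by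
  let ι := {φ : A ≃* A // φ ≠ 1} ⊕ ({e : A // e ≠ 1} × {χ : A →* ℂˣ // χ ≠ 1})
  let K : ι → Subgroup A :=
    Sum.elim (fun φ => MonoidHom.eqLocus φ.1.toMonoidHom (MonoidHom.id A)) fun q => q.2.1.ker
  let f : ι → A → A := Sum.elim (fun φ => φ.1) fun q x => x * q.1.1
  have hK : ∀ i, K i ≠ ⊤ := by
    rintro (⟨φ, hφ⟩ | ⟨e, χ, hχ⟩) h
    · exact hφ (MulEquiv.ext fun x => h.ge (Subgroup.mem_top x))
    · exact hχ (MonoidHom.ext fun x => h.ge (Subgroup.mem_top x))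
  have hf : ∀ i, ∀ x ∉ K i, f i x ≠ x := by
    rintro (⟨φ, hφ⟩ | ⟨⟨e, he⟩, χ⟩) x hx
    · exact hx
    · simpa [f] using he
  have hfin : Finite (A →* ℂˣ) := Nat.finite_of_card_ne_zero (by
    rw [CommGroup.card_monoidHom_of_hasEnoughRootsOfUnity]; exact Nat.card_pos.ne')
  have hcard : (Nat.card ι : ℝ) ≤ 2 ^ (Real.logb 2 (Nat.card A)) ^ 2 + (Nat.card A : ℝ) ^ 2 := by
    rw [Nat.card_sum, Nat.card_prod]
    push_cast
    refine add_le_add (le_trans ?_ (card_mulEquiv_le A)) ?_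
    · exact_mod_cast Finite.card_subtype_le _
    · rw [sq]
      have h1 : Nat.card {e : A // e ≠ 1} ≤ Nat.card A := Finite.card_subtype_le _
      have h2 : Nat.card {χ : A →* ℂˣ // χ ≠ 1} ≤ Nat.card A :=
        (Finite.card_subtype_le _).trans_eq
          (CommGroup.card_monoidHom_of_hasEnoughRootsOfUnity A ℂ)
      exact_mod_cast Nat.mul_le_mul h1 h2
  refine le_trans (ncard_le_card_mul_of_subset_iUnion
    (t := fun i => {S : Set A | S ⊆ (B : Set A)ᶜ ∧ ∀ x ∉ K i, (x ∈ S ↔ f i x ∈ S)}) ?_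
    fun i => ncard_invariant_off_subgroup_le hB (hK i) (hf i)) (by gcongr)
  rintro S ⟨hS, hSD⟩
  rw [hasBipartition_cayleyDigraph_iff hB] at hS
  rw [Set.mem_iUnion]
  rcases exists_invariance_of_not_isDRR hSD with ⟨φ, hφ, h⟩ | ⟨Z, hZ, e, he, h⟩
  · exact ⟨Sum.inl ⟨φ, hφ⟩, hS, fun x _ => h x⟩
  · obtain ⟨χ, hχ, hle⟩ := exists_character_ker_of_ne_top hZ
    exact ⟨Sum.inr ⟨⟨e, he⟩, χ, hχ⟩, hS, fun x hx => h x fun hxZ => hx (hle hxZ)⟩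

/-! ### Passing to isomorphism classes. -/

/-- An isomorphism normalised to fix `1` conjugates translations, which are automorphisms of the
source, to automorphisms of the target; these are translations since `S'` is a DRR. So it is
multiplicative. -/
theorem exists_mulEquiv_of_isDRR {A : Type*} [CommGroup A] {S S' : Set A} (hS' : IsDRR S')
    (h : (cayleyDigraph S).unlabelled = (cayleyDigraph S').unlabelled) :
    ∃ φ : A ≃* A, φ '' S = S' := by
  obtain ⟨σ₀⟩ : Nonempty ((cayleyDigraph S).Adj ≃r (cayleyDigraph S').Adj) := Quotient.exact h
  let σ : Equiv.Perm A := Equiv.mulRight (σ₀ 1)⁻¹ * σ₀.toEquiv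
  have hσ : ∀ u v, (cayleyDigraph S').Adj (σ u) (σ v) ↔ (cayleyDigraph S).Adj u v := by
    intro u v
    rw [← σ₀.map_rel_iff]
    simp [σ, cayleyDigraph]
  have hσ1 : σ 1 = 1 := by simp [σ]
  have hmul : ∀ x a, σ (x * a) = σ x * σ a := by
    intro x a
    have hmem : σ * Equiv.mulRight a * σ⁻¹ ∈ rightRegular A := by
      rw [← hS']
      intro u v
      have e : ∀ w, (σ * Equiv.mulRight a * σ⁻¹) w = σ (σ⁻¹ w * a) := fun w => rfl
      rw [e, e, hσ, ← perm_apply_inv_apply σ u, ← perm_apply_inv_apply σ v, hσ]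
      simp [cayleyDigraph]
    obtain ⟨b, hb⟩ := mem_rightRegular_iff.1 hmem
    have hb' : ∀ x, σ (x * a) = σ x * b := fun x => by simpa using hb (σ x)
    have := hb' 1
    rw [one_mul, hσ1, one_mul] at this
    rw [hb', this]
  refine ⟨{ σ with map_mul' := hmul }, ?_⟩
  have hmem : ∀ x, σ x ∈ S' ↔ x ∈ S := fun x => by
    simpa [cayleyDigraph, hσ1] using hσ x 1
  ext y
  constructor
  · rintro ⟨x, hx, rfl⟩
    exact (hmem x).2 hx
  · intro hy
    refine ⟨σ⁻¹ y, ?_, perm_apply_inv_apply σ y⟩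
    rw [← hmem, perm_apply_inv_apply]
    exact hy

theorem unlabelledBipartiteDRR_subset {A : Type*} [Group A] {B : Subgroup A} :
    unlabelledBipartiteDRR B ⊆ unlabelledBipartiteCayley B := by
  rintro q ⟨S, hS, -, hq⟩
  exact ⟨S, hS, hq⟩

section Classes

variable {A : Type*} [CommGroup A] [Finite A] {B : Subgroup A}

theorem finite_unlabelledDigraph (V : Type*) [Finite V] : Finite (UnlabelledDigraph V) := by
  have : Finite (Digraph V) :=
    Finite.of_injective (fun Γ : Digraph V => Γ.Adj) fun Γ Δ h => Digraph.ext h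
  exact Quotient.finite _

theorem ncard_hasBipartition (hB : B.index = 2) :
    (({S : Set A | HasBipartition (cayleyDigraph S) (B : Set A)} : Set (Set A)).ncard : ℝ)
      = 2 ^ ((Nat.card A : ℝ) / 2) := by
  have h : {S : Set A | HasBipartition (cayleyDigraph S) (B : Set A)} = 𝒫 (B : Set A)ᶜ := by
    ext S
    exact hasBipartition_cayleyDigraph_iff hB
  have h2 : (2 : ℝ) * ((B : Set A)ᶜ).ncard = Nat.card A := by
    exact_mod_cast two_mul_ncard_compl_of_index_eq_two hB
  rw [h, Set.ncard_powerset _ (Set.toFinite _), ← h2, mul_div_cancel_left₀ _ two_ne_zero,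
    Real.rpow_natCast]
  norm_cast

theorem two_rpow_le_ncard_unlabelledBipartiteDRR (hB : B.index = 2) :
    (2 : ℝ) ^ ((Nat.card A : ℝ) / 2) - (bipartiteNonDRR B).ncard
      ≤ 2 ^ (Real.logb 2 (Nat.card A)) ^ 2 * (unlabelledBipartiteDRR B).ncard := by
  classical
  have := finite_unlabelledDigraph A
  let D : Set (Set A) := {S | HasBipartition (cayleyDigraph S) (B : Set A) ∧ IsDRR S}
  have h1 : (2 : ℝ) ^ ((Nat.card A : ℝ) / 2) ≤ D.ncard + (bipartiteNonDRR B).ncard := by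
    rw [← ncard_hasBipartition hB]
    have hsub : {S : Set A | HasBipartition (cayleyDigraph S) (B : Set A)}
        ⊆ D ∪ bipartiteNonDRR B := fun S hS => by
      by_cases h : IsDRR S
      · exact Or.inl ⟨hS, h⟩
      · exact Or.inr ⟨hS, h⟩
    exact_mod_cast (Set.ncard_le_ncard hsub).trans (Set.ncard_union_le _ _)
  have hrep : ∀ q : unlabelledBipartiteDRR B, ∃ S : Set A,
      (cayleyDigraph S).unlabelled = q.1 := by
    rintro ⟨q, S, -, -, hq⟩
    exact ⟨S, hq⟩
  choose rep hrep using hrep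
  have h2 : (D.ncard : ℝ) ≤ Nat.card ((A ≃* A) × unlabelledBipartiteDRR B) * 1 := by
    refine ncard_le_card_mul_of_subset_iUnion (t := fun q => {q.1 '' rep q.2}) ?_ (by simp)
    rintro S ⟨hS, hSD⟩
    let q : unlabelledBipartiteDRR B := ⟨(cayleyDigraph S).unlabelled, S, hS, hSD, rfl⟩
    obtain ⟨φ, hφ⟩ := exists_mulEquiv_of_isDRR hSD (hrep q)
    exact Set.mem_iUnion.2 ⟨(φ, q), hφ.symm⟩
  rw [Nat.card_prod, mul_one, Nat.cast_mul] at h2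
  have h3 : (D.ncard : ℝ) ≤ 2 ^ (Real.logb 2 (Nat.card A)) ^ 2 *
      (unlabelledBipartiteDRR B).ncard :=
    h2.trans (mul_le_mul_of_nonneg_right (card_mulEquiv_le A) (Nat.cast_nonneg _))
  linarith

theorem ncard_unlabelledBipartiteDRR_le :
    (unlabelledBipartiteDRR B).ncard ≤ (unlabelledBipartiteCayley B).ncard :=
  have := finite_unlabelledDigraph A
  Set.ncard_le_ncard unlabelledBipartiteDRR_subset

theorem ncard_unlabelledBipartiteCayley_le :
    (unlabelledBipartiteCayley B).ncard
      ≤ (unlabelledBipartiteDRR B).ncard + (bipartiteNonDRR B).ncard := by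
  have := finite_unlabelledDigraph A
  have hsub : unlabelledBipartiteCayley B ⊆ unlabelledBipartiteDRR B ∪
      (fun S : Set A => (cayleyDigraph S).unlabelled) '' bipartiteNonDRR B := by
    rintro q ⟨S, hS, hq⟩
    by_cases h : IsDRR S
    · exact Or.inl ⟨S, hS, h, hq⟩
    · exact Or.inr ⟨S, ⟨hS, h⟩, hq⟩
  calc _ ≤ _ := Set.ncard_le_ncard hsub
    _ ≤ _ := Set.ncard_union_le _ _
    _ ≤ _ := Nat.add_le_add_left (Set.ncard_image_le (Set.toFinite _)) _

theorem sq_card_le_two_rpow (h4 : 4 ≤ Nat.card A) :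
    (Nat.card A : ℝ) ^ 2 ≤ 2 ^ (Real.logb 2 (Nat.card A)) ^ 2 := by
  have hlog : 2 ≤ Real.logb 2 (Nat.card A : ℝ) := by
    rw [Real.le_logb_iff_rpow_le one_lt_two (by exact_mod_cast Nat.card_pos)]
    norm_num
    exact h4
  calc (Nat.card A : ℝ) ^ 2 = 2 ^ (Real.logb 2 (Nat.card A) * (2 : ℕ)) := by
        rw [Real.rpow_mul two_pos.le, ← card_eq_two_rpow_logb, Real.rpow_natCast]
    _ ≤ _ := by
      apply Real.rpow_le_rpow_of_exponent_le one_le_two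
      push_cast
      nlinarith

theorem ncard_bipartiteNonDRR_le_of_four_le (hB : B.index = 2) (h4 : 4 ≤ Nat.card A) :
    ((bipartiteNonDRR B).ncard : ℝ)
      ≤ 2 * 2 ^ (Real.logb 2 (Nat.card A)) ^ 2 * 2 ^ (3 * (Nat.card A : ℝ) / 8) := by
  refine (ncard_bipartiteNonDRR_le hB).trans (mul_le_mul_of_nonneg_right ?_ (by positivity))
  linarith [sq_card_le_two_rpow h4]

theorem two_rpow_sub_le_ncard_unlabelledBipartiteDRR (hB : B.index = 2) (h4 : 4 ≤ Nat.card A) :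
    (2 : ℝ) ^ ((Nat.card A : ℝ) / 2 - (Real.logb 2 (Nat.card A : ℝ)) ^ 2)
        - 2 * 2 ^ (3 * (Nat.card A : ℝ) / 8) ≤ (unlabelledBipartiteDRR B).ncard := by
  have h1 := two_rpow_le_ncard_unlabelledBipartiteDRR hB
  have h2 := ncard_bipartiteNonDRR_le_of_four_le hB h4
  have hpos : (0 : ℝ) < 2 ^ (Real.logb 2 (Nat.card A)) ^ 2 := by positivity
  rw [← mul_le_mul_iff_right₀ hpos, mul_sub, Real.rpow_sub two_pos, mul_div_cancel₀ _ hpos.ne']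
  linarith

theorem two_rpow_sub_le_ncard_unlabelledBipartiteCayley (hB : B.index = 2) :
    (2 : ℝ) ^ ((Nat.card A : ℝ) / 2 - (Real.logb 2 (Nat.card A : ℝ)) ^ 2)
        - 3 * (2 : ℝ) ^ (3 * (Nat.card A : ℝ) / 8) ≤ (unlabelledBipartiteCayley B).ncard := by
  have hpos : (0 : ℝ) < 2 ^ (3 * (Nat.card A : ℝ) / 8) := by positivity
  by_cases h4 : 4 ≤ Nat.card A
  · have h1 := two_rpow_sub_le_ncard_unlabelledBipartiteDRR hB h4
    have h2 : ((unlabelledBipartiteDRR B).ncard : ℝ) ≤ (unlabelledBipartiteCayley B).ncard := by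
      exact_mod_cast ncard_unlabelledBipartiteDRR_le
    linarith
  -- For tiny groups the left side is negative: `|A|/2 ≤ 1 + 3|A|/8` already bounds the first term.
  · have h4' : (Nat.card A : ℝ) < 4 := by exact_mod_cast not_le.1 h4
    have hle : (2 : ℝ) ^ ((Nat.card A : ℝ) / 2 - (Real.logb 2 (Nat.card A : ℝ)) ^ 2)
        ≤ 2 * 2 ^ (3 * (Nat.card A : ℝ) / 8) := by
      rw [← Real.rpow_one_add' two_pos.le (by positivity)]
      apply Real.rpow_le_rpow_of_exponent_le one_le_two
      nlinarith [sq_nonneg (Real.logb 2 (Nat.card A : ℝ))]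
    have : (0 : ℝ) ≤ (unlabelledBipartiteCayley B).ncard := Nat.cast_nonneg _
    linarith

theorem abs_div_sub_one_le (hB : B.index = 2) (h4 : 4 ≤ Nat.card A) {δ : ℝ} (hδ : δ < 1)
    (h : 2 * (2 : ℝ) ^ (2 * (Real.logb 2 (Nat.card A : ℝ)) ^ 2 - (Nat.card A : ℝ) / 8) ≤ δ) :
    |((unlabelledBipartiteDRR B).ncard : ℝ) / ((unlabelledBipartiteCayley B).ncard : ℝ) - 1|
      ≤ δ / (1 - δ) := by
  set n : ℝ := (Nat.card A : ℝ) with hn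
  set l : ℝ := (Real.logb 2 n) ^ 2 with hl
  have hd := two_rpow_sub_le_ncard_unlabelledBipartiteDRR hB h4
  have hm := ncard_bipartiteNonDRR_le_of_four_le hB h4
  have hu : ((unlabelledBipartiteCayley B).ncard : ℝ)
      ≤ (unlabelledBipartiteDRR B).ncard + (bipartiteNonDRR B).ncard := by
    exact_mod_cast ncard_unlabelledBipartiteCayley_le
  have hdu : ((unlabelledBipartiteDRR B).ncard : ℝ) ≤ (unlabelledBipartiteCayley B).ncard := by
    exact_mod_cast ncard_unlabelledBipartiteDRR_le
  rw [← hn, ← hl] at hd hm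
  set d : ℝ := ((unlabelledBipartiteDRR B).ncard : ℝ)
  set u : ℝ := ((unlabelledBipartiteCayley B).ncard : ℝ)
  -- `P` is the main term. The non-DRR sets number at most `δ * P` and the DRR classes at least `(1
  -- - δ) * P`, which gives the ratio `δ / (1 - δ)`.
  set P : ℝ := 2 ^ (n / 2 - l) with hP
  have hP0 : 0 < P := by positivity
  have hl0 : 0 ≤ l := sq_nonneg _
  have e1 : 2 * (2 : ℝ) ^ l * 2 ^ (3 * n / 8) = 2 * 2 ^ (2 * l - n / 8) * P := by
    rw [hP, mul_assoc, mul_assoc, ← Real.rpow_add two_pos, ← Real.rpow_add two_pos]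
    congr 2
    ring
  have h1l : (1 : ℝ) ≤ 2 ^ l := Real.one_le_rpow one_le_two hl0
  have hm' : ((bipartiteNonDRR B).ncard : ℝ) ≤ δ * P :=
    hm.trans (e1.trans_le (mul_le_mul_of_nonneg_right h hP0.le))
  have hq0 : (0 : ℝ) < 2 ^ (3 * n / 8) := by positivity
  have hq : 2 * 2 ^ (3 * n / 8) ≤ δ * P := by
    refine le_trans ?_ (e1.trans_le (mul_le_mul_of_nonneg_right h hP0.le))
    nlinarith
  have hd' : (1 - δ) * P ≤ d := by linarith
  have h1δ : 0 < 1 - δ := sub_pos.2 hδ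
  have hu0 : 0 < u := (mul_pos h1δ hP0).trans_le (hd'.trans hdu)
  rw [div_sub_one hu0.ne', abs_div, abs_of_pos hu0, abs_sub_comm, abs_of_nonneg (sub_nonneg.2 hdu),
    div_le_div_iff₀ hu0 h1δ]
  have hδ0 : 0 < δ := lt_of_lt_of_le (by positivity) h
  nlinarith

end Classes

/-! ### Asymptotics and conclusion. -/

theorem tendsto_two_mul_two_rpow_logb_sq_sub :
    Filter.Tendsto (fun n : ℕ => 2 * (2 : ℝ) ^ (2 * (Real.logb 2 (n : ℝ)) ^ 2 - (n : ℝ) / 8))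
      Filter.atTop (nhds 0) := by
  have h1 : Filter.Tendsto (fun x : ℝ => 2 * (Real.logb 2 x) ^ 2 - x / 8) Filter.atTop
      Filter.atBot := by
    have ho : (fun x : ℝ => 2 * (Real.logb 2 x) ^ 2) =o[Filter.atTop] fun x : ℝ => x := by
      have h := (Real.isLittleO_pow_log_id_atTop (n := 2)).const_mul_left (2 / Real.log 2 ^ 2)
      refine h.congr_left fun x => ?_
      simp only [Real.logb]
      ring
    have hb := ho.bound (c := 1 / 16) (by norm_num)
    refine Filter.tendsto_atBot_mono' _ ?_
      (Filter.tendsto_neg_atTop_atBot.comp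
        (Filter.tendsto_id.atTop_div_const (show (0 : ℝ) < 16 by norm_num)))
    filter_upwards [hb, Filter.eventually_ge_atTop 0] with x hx hx0
    rw [Real.norm_eq_abs, Real.norm_eq_abs, abs_of_nonneg hx0] at hx
    have := (le_abs_self _).trans hx
    simp only [Function.comp_apply, id]
    linarith
  have h2 : Filter.Tendsto (fun y : ℝ => 2 * (2 : ℝ) ^ y) Filter.atBot (nhds 0) := by
    simpa using (tendsto_rpow_atBot_of_base_gt_one 2 one_lt_two).const_mul 2
  exact h2.comp (h1.comp tendsto_natCast_atTop_atTop)

theorem theorem1p5 :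
    (∀ (A : Type*) [CommGroup A] [Finite A] (B : Subgroup A), B.index = 2 →
      (2 : ℝ) ^ ((Nat.card A : ℝ) / 2 - (Real.logb 2 (Nat.card A : ℝ)) ^ 2)
          - 3 * (2 : ℝ) ^ (3 * (Nat.card A : ℝ) / 8)
        ≤ ((unlabelledBipartiteCayley B).ncard : ℝ)) ∧
    (∀ ε : ℝ, 0 < ε → ∃ N : ℕ,
      ∀ (A : Type*) [CommGroup A] [Finite A] (B : Subgroup A), B.index = 2 →
        N ≤ Nat.card A →
        |((unlabelledBipartiteDRR B).ncard : ℝ) / ((unlabelledBipartiteCayley B).ncard : ℝ) - 1|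
          < ε) := by
  refine ⟨fun A _ _ B hB => two_rpow_sub_le_ncard_unlabelledBipartiteCayley hB, fun ε hε => ?_⟩
  -- This `δ` solves `δ / (1 - δ) = ε / 2`.
  have hδ0 : 0 < ε / (2 + ε) := by positivity
  obtain ⟨N, hN⟩ := Filter.eventually_atTop.1
    (tendsto_two_mul_two_rpow_logb_sq_sub.eventually_le_const hδ0)
  refine ⟨max 4 N, fun A _ _ B hB hA => ?_⟩
  have hδ1 : ε / (2 + ε) < 1 := by
    rw [div_lt_one (by positivity)]
    linarith
  refine (abs_div_sub_one_le hB ((le_max_left _ _).trans hA) hδ1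
    (hN _ ((le_max_right _ _).trans hA))).trans_lt ?_
  have e : ε / (2 + ε) / (1 - ε / (2 + ε)) = ε / 2 := by
    field_simp
    ring
  rw [e]
  linarith
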